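/- Let $n\ge 0$ and let $d$ be a metric on $\mathbb{R}^n$ that is continuous on $\mathbb{R}^n\times\mathbb{R}^n$ for the usual topology and has approximate midpoints: for all $x,y$ and all $r>d(x,y)/2$ there is $m$ with $d(x,m)<r$ and $d(m,y)<r$ (for example, any metric induced by a norm, such as the Euclidean one). Let $\varepsilon\ge 0$. Let $\nu$ be a Borel probability measure on $\mathbb{R}^n\times\{0,1\}$, let $(X,Y)\sim\nu$ and $w_i=\mathbb{P}(Y=i)$, and suppose that, for $i=0,1$, the conditional distribution of $X$ given $Y=i$ has a probability density $\rho_i$ with respect to Lebesgue measure, i.e. $\nu(E\times\{i\})=w_i\int_E\rho_i\,dx$ for all Borel sets $E$. (The weights $w_0,w_1\ge 0$ with $w_0+w_1=1$ are otherwise arbitrary.) Let $\nu^S$ be the measure obtained from $\nu$ by swapping the labels, $\nu^S(E\times\{1\})=\nu(E\times\{0\})$ and $\nu^S(E\times\{0\})=\nu(E\times\{1\})$, and let $\Gamma(\nu,\nu^S)$ be the set of couplings of $\nu$ and $\nu^S$. For $z_i=(x_i,y_i)$ let $c_\varepsilon(z_1,z_2)=1$ if $d(x_1,x_2)>2\varepsilon$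 or $y_1\ne y_2$, and $c_\varepsilon(z_1,z_2)=0$ otherwise. For a set $A\subseteq\mathbb{R}^n$ and $s\in\mathbb{R}$ let $A^s=\{x:\tilde d_A(x)\le s\}$, where $\tilde d_A(x)=\inf_{y\in A}d(x,y)$ if $x\notin A$ and $\tilde d_A(x)=-\inf_{y\in A^c}d(x,y)$ if $x\in A$ (with $\inf\emptyset=+\infty$). Then, with the suprema (which are finite) taken over all Borel subsets of $\mathbb{R}^n$, \[ 2\sup_{B}\Big\{\int_{B^{-\varepsilon}}w_1\rho_1\,dx-\int_{B^{\varepsilon}}w_0\rho_0\,dx\Big\}-w_1+w_0 =\inf_{\pi\in\Gamma(\nu,\nu^S)}\int c_\varepsilon(z_1,z_2)\,d\pi(z_1,z_2) \] and \[ 2\sup_{A}\Big\{\int_{A^{-\varepsilon}}w_0\rho_0\,dx-\int_{A^{\varepsilon}}w_1\rho_1\,dx\Big\}-w_0+w_1 =\inf_{\pi\in\Gamma(\nu,\nu^S)}\int c_\varepsilon(z_1,z_2)\,d\pi(z_1,z_2). \] -/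

import Mathlib

open MeasureTheory

noncomputable section

/-- The Euclidean space `ℝⁿ`, carrying its usual topology, Borel sets and Lebesgue measure. -/
abbrev RSpace (n : ℕ) : Type := EuclideanSpace ℝ (Fin n)

/-- The space of labelled points `z = (x, y)`, with label `y ∈ {0, 1}`. -/
abbrev Labelled (n : ℕ) : Type := RSpace n × Fin 2

/-- `d` is a metric on the set `X`. -/
structure IsMetric {X : Type*} (d : X → X → ℝ) : Prop where
  eq_zero_iff : ∀ x y, d x y = 0 ↔ x = y
  symm : ∀ x y, d x y = d y x
  triangle : ∀ x y z, d x z ≤ d x y + d y z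

/-- Approximate midpoints: every length metric (in particular every metric that comes from
a norm) has them. -/
def HasApproxMidpoints {X : Type*} (d : X → X → ℝ) : Prop :=
  ∀ x y, ∀ r : ℝ, d x y / 2 < r → ∃ m, d x m < r ∧ d m y < r

/-- The distance `d(x, A) = inf_{y ∈ A} d(x, y)`; it is `+∞` if `A` is empty. -/
def distToSet {X : Type*} (d : X → X → ℝ) (x : X) (A : Set X) : EReal :=
  ⨅ y ∈ A, (d x y : EReal)

open Classical in
/-- The signed distance to `A`: `d(x, A)` outside of `A` and `-d(x, Aᶜ)` inside of `A`. -/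
def signedDistTo {X : Type*} (d : X → X → ℝ) (A : Set X) (x : X) : EReal :=
  if x ∈ A then -distToSet d x Aᶜ else distToSet d x A

/-- The set `A^s` of all points whose signed distance to `A` is at most `s`:
a dilation of `A` for `s > 0` and an erosion of `A` for `s < 0`. -/
def offset {X : Type*} (d : X → X → ℝ) (A : Set X) (s : ℝ) : Set X :=
  {x | signedDistTo d A x ≤ (s : EReal)}

/-- `f` is a probability density on `ℝⁿ` with respect to Lebesgue measure. -/
structure IsProbDensity {n : ℕ} (f : RSpace n → ℝ) : Prop where
  measurable : Measurable f
  nonneg : ∀ x, 0 ≤ f x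
  lintegral_eq_one : ∫⁻ x, ENNReal.ofReal (f x) = 1

/-- The class weight `w_i = P(Y = i)` for `(X, Y) ∼ ν`. -/
def classWeight {n : ℕ} (ν : Measure (Labelled n)) (i : Fin 2) : ℝ :=
  ν.real (Set.univ ×ˢ {i})

/-- For `(X, Y) ∼ ν`, the conditional distribution of `X` given `Y = i` is `f dx`, that is,
`P(X ∈ E, Y = i) = P(Y = i) ∫_E f dx` for all Borel sets `E`. -/
def HasConditionalDensity {n : ℕ} (ν : Measure (Labelled n)) (i : Fin 2)
    (f : RSpace n → ℝ) : Prop :=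
  ∀ E : Set (RSpace n), MeasurableSet E →
    ν (E ×ˢ {i}) = ν (Set.univ ×ˢ {i}) * ∫⁻ x in E, ENNReal.ofReal (f x)

/-- The distribution `ν^S`: the image of `ν` when the two labels are swapped. -/
def labelSwap {n : ℕ} (ν : Measure (Labelled n)) : Measure (Labelled n) :=
  ν.map (fun z => (z.1, Equiv.swap (0 : Fin 2) 1 z.2))

/-- `π ∈ Γ(μ, ν)`: `π` has first marginal `μ` and second marginal `ν`. -/
def IsCoupling {Z : Type*} [MeasurableSpace Z] (π : Measure (Z × Z)) (μ ν : Measure Z) : Prop :=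
  π.map Prod.fst = μ ∧ π.map Prod.snd = ν

/-- The cost `c_ε(z₁, z₂)`: it is `1` if `d(x₁, x₂) > 2ε` or `y₁ ≠ y₂`, and `0` otherwise. -/
def advCost {X : Type*} (d : X → X → ℝ) (ε : ℝ) (z₁ z₂ : X × Fin 2) : ℝ :=
  if d z₁.1 z₂.1 > 2 * ε ∨ z₁.2 ≠ z₂.2 then 1 else 0

/-- The number `∫_{B^{-ε}} f dx - ∫_{B^ε} g dx`. -/
def robustGain {n : ℕ} (d : RSpace n → RSpace n → ℝ) (ε : ℝ) (f g : RSpace n → ℝ)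
    (B : Set (RSpace n)) : ℝ :=
  (∫ x in offset d B (-ε), f x) - ∫ x in offset d B ε, g x

end

/-! By Strassen's theorem, the cost of a best coupling of `μ` and `ν` for the indicator of the
complement of a closed relation `R` is the excess of `μ` over `ν` along `R`, the supremum of
`μ K - ν (R[K])` over compact sets `K`. On compact spaces this is linear programming duality, where
potentials with `f ⊕ g ≥ 𝟙_R` are cut into superlevel sets: `R` maps `{f < t}` into
`{g ≥ 1 - t}`.

Let `R` be the relation `d ≤ 2ε`. By the approximate midpoints `R[B^{-ε}] ⊆ B^ε`, and for
`B = K^ε` the two sides nearly agree: `K ⊆ B^{-ε}` and `B^ε ⊆ R[K]`. Hence the supremum of the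
gains is the excess along `R` of one class over the other. As the cost forbids transport between
different labels, the coupling of `ν` with its swap splits into one transport problem for each of
the two ordered pairs of classes, and as `R` is symmetric, taking complements shows that the two
excesses differ by `w₁ - w₀`. -/

open Set Topology SetRel
open scoped CompactlySupported

section Excess

variable {X Y : Type*} [TopologicalSpace X] [MeasurableSpace X] [MeasurableSpace Y]

/-- The *excess* of `μ` over `ν` along a relation `R`: the largest defect, over compact sets `K`,
of Hall's condition `μ K ≤ ν (R[K])`. -/
noncomputable def hallExcess (R : SetRel X Y) (μ : Measure X) (ν : Measure Y) : ℝ :=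
  ⨆ K : TopologicalSpace.Compacts X, (μ.real K - ν.real (R.image K))

variable {R : SetRel X Y} {μ : Measure X} {ν : Measure Y}

theorem hallExcess_le {c : ℝ} (h : ∀ K, IsCompact K → μ.real K - ν.real (R.image K) ≤ c) :
    hallExcess R μ ν ≤ c :=
  ciSup_le fun K => h K K.isCompact

variable [IsFiniteMeasure μ]

theorem sub_le_hallExcess {K : Set X} (hK : IsCompact K) :
    μ.real K - ν.real (R.image K) ≤ hallExcess R μ ν := by
  refine le_ciSup (f := fun K : TopologicalSpace.Compacts X => μ.real K - ν.real (R.image K))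
    ⟨μ.real univ, ?_⟩ ⟨K, hK⟩
  rintro _ ⟨L, rfl⟩
  exact (sub_le_self _ measureReal_nonneg).trans (measureReal_mono (subset_univ _))

theorem sub_le_hallExcess_of_image_subset [μ.InnerRegularCompactLTTop] [IsFiniteMeasure ν]
    {B : Set X} {C : Set Y} (hB : MeasurableSet B) (hBC : R.image B ⊆ C) :
    μ.real B - ν.real C ≤ hallExcess R μ ν := by
  refine le_of_forall_pos_le_add fun δ hδ => ?_
  obtain ⟨K, hKB, hK, hlt⟩ := hB.exists_isCompact_lt_add (μ := μ) (measure_ne_top μ B)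
    (ENNReal.ofReal_pos.2 hδ).ne'
  have hμ : μ.real B ≤ μ.real K + δ := by
    rw [← ENNReal.toReal_ofReal hδ.le, measureReal_def, measureReal_def,
      ← ENNReal.toReal_add (measure_ne_top μ K) ENNReal.ofReal_ne_top]
    exact ENNReal.toReal_mono (by finiteness) hlt.le
  have hν : ν.real (R.image K) ≤ ν.real C :=
    measureReal_mono ((image_subset_image hKB).trans hBC)
  linarith [sub_le_hallExcess (R := R) (μ := μ) (ν := ν) hK]

/-- A point outside `R[K]` is `R`-related to no point of `K`, so complementation turns Hall's
condition for `R` into the one for its inverse. -/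
theorem hallExcess_le_hallExcess_inv_add [TopologicalSpace Y] [BorelSpace Y] [IsFiniteMeasure ν]
    [T2Space X] [OpensMeasurableSpace X] [ν.InnerRegularCompactLTTop] (hR : IsClosed R) :
    hallExcess R μ ν ≤ hallExcess R.inv ν μ + μ.real univ - ν.real univ := by
  refine hallExcess_le fun K hK => ?_
  have hN : MeasurableSet (R.image K) := (hR.relImage_of_isCompact hK).measurableSet
  have hsub : R.inv.image (R.image K)ᶜ ⊆ Kᶜ := by
    rintro x ⟨y, hy, hxy⟩ hxK
    exact hy ⟨x, hxK, hxy⟩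
  have := sub_le_hallExcess_of_image_subset (μ := ν) (ν := μ) hN.compl hsub
  rw [measureReal_compl hN, measureReal_compl hK.measurableSet] at this
  linarith

theorem hallExcess_fst_snd_le {π : Measure (X × Y)} [IsFiniteMeasure π] [T2Space X]
    [OpensMeasurableSpace X] :
    hallExcess R π.fst π.snd ≤ π.real Rᶜ := by
  refine hallExcess_le fun K hK => ?_
  have hsub : Prod.fst ⁻¹' K ⊆ Rᶜ ∪ Prod.snd ⁻¹' R.image K := by
    rintro ⟨x, y⟩ hx
    by_cases hR : (x, y) ∈ R
    exacts [.inr ⟨x, hx, hR⟩, .inl hR]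
  have hfst : π.fst.real K = π.real (Prod.fst ⁻¹' K) := by
    rw [measureReal_def, Measure.fst_apply hK.measurableSet, measureReal_def]
  have hsnd : π.real (Prod.snd ⁻¹' R.image K) ≤ π.snd.real (R.image K) :=
    ENNReal.toReal_mono (measure_ne_top _ _) (Measure.le_map_apply measurable_snd.aemeasurable _)
  linarith [measureReal_mono (μ := π) hsub,
    measureReal_union_le (μ := π) Rᶜ (Prod.snd ⁻¹' R.image K)]

end Excess

section Kantorovich

theorem exists_isFiniteMeasure_integral_eq {X : Type*} [TopologicalSpace X] [CompactSpace X]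
    [T2Space X] [MeasurableSpace X] [BorelSpace X] (L : C(X, ℝ) →ₗ[ℝ] ℝ)
    (hL : ∀ f, 0 ≤ f → 0 ≤ L f) :
    ∃ μ : Measure X, IsFiniteMeasure μ ∧ ∀ f : C(X, ℝ), ∫ x, f x ∂μ = L f := by
  let Λ : C_c(X, ℝ) →ₚ[ℝ] ℝ := PositiveLinearMap.mk₀
    { toFun := fun f => L f.toContinuousMap
      map_add' := fun f g => map_add L f.toContinuousMap g.toContinuousMap
      map_smul' := fun c f => map_smul L c f.toContinuousMap } fun f hf => hL _ hf
  exact ⟨RealRMK.rieszMeasure Λ, inferInstance, fun f =>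
    RealRMK.integral_rieszMeasure Λ (CompactlySupportedContinuousMap.continuousMapEquiv f)⟩

variable {X Y : Type*} [TopologicalSpace X] [TopologicalSpace Y] [CompactSpace X] [CompactSpace Y]
  [MeasurableSpace X] [MeasurableSpace Y] [BorelSpace X] [BorelSpace Y]

theorem integrable_continuousMap (f : C(X, ℝ)) (μ : Measure X)
    [IsFiniteMeasure μ] : Integrable f μ :=
  f.continuous.integrable_of_hasCompactSupport (.of_compactSpace f)

/-- The cone of continuous functions that dominate a sum `f ⊕ g` of two potentials of nonnegative
total integral plus a nonnegative multiple of `φ - c`. A positive functional with marginals `μ` and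
`ν` whose value on `φ` is at least `c` has to be nonnegative on it. -/
def kantorovichCone (μ : Measure X) (ν : Measure Y) [IsFiniteMeasure μ] [IsFiniteMeasure ν]
    (φ : X × Y → ℝ) (c : ℝ) : PointedCone ℝ C(X × Y, ℝ) where
  carrier := {h | ∃ (f : C(X, ℝ)) (g : C(Y, ℝ)) (t : ℝ), 0 ≤ ∫ x, f x ∂μ + ∫ y, g y ∂ν ∧ 0 ≤ t ∧
    ∀ p : X × Y, f p.1 + g p.2 + t * (φ p - c) ≤ h p}
  zero_mem' := ⟨0, 0, 0, by simp⟩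
  add_mem' := by
    rintro h h' ⟨f, g, t, hfg, ht, H⟩ ⟨f', g', t', hfg', ht', H'⟩
    refine ⟨f + f', g + g', t + t', ?_, add_nonneg ht ht', fun p => ?_⟩
    · simp only [ContinuousMap.add_apply]
      rw [integral_add (integrable_continuousMap f μ) (integrable_continuousMap f' μ),
        integral_add (integrable_continuousMap g ν) (integrable_continuousMap g' ν)]
      linarith
    · simp only [ContinuousMap.add_apply]
      linarith [H p, H' p]
  smul_mem' := by
    rintro ⟨a, ha⟩ h ⟨f, g, t, hfg, ht, H⟩
    refine ⟨a • f, a • g, a * t, ?_, mul_nonneg ha ht, fun p => ?_⟩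
    · simp only [ContinuousMap.smul_apply, integral_smul, ← smul_add]
      exact smul_nonneg ha hfg
    · calc (a • f) p.1 + (a • g) p.2 + a * t * (φ p - c)
          = a * (f p.1 + g p.2 + t * (φ p - c)) := by
            simp only [ContinuousMap.smul_apply, smul_eq_mul]; ring
        _ ≤ a * h p := mul_le_mul_of_nonneg_left (H p) ha

variable {μ : Measure X} {ν : Measure Y} [IsProbabilityMeasure μ] [IsProbabilityMeasure ν]
  {φ : X × Y → ℝ} {c : ℝ}

theorem integral_add_integral_le_of_add_le {f : C(X, ℝ)} {g : C(Y, ℝ)} {a : ℝ}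
    (h : ∀ x y, f x + g y ≤ a) : ∫ x, f x ∂μ + ∫ y, g y ∂ν ≤ a := by
  have hg : ∀ x, ∫ y, g y ∂ν ≤ a - f x := fun x => by
    simpa using integral_mono (integrable_continuousMap g ν) (integrable_const (a - f x))
      fun y => le_sub_iff_add_le'.2 (h x y)
  have hf := integral_mono (integrable_continuousMap f μ)
    (integrable_const (a - ∫ y, g y ∂ν)) fun x => le_sub_comm.1 (hg x)
  simp only [integral_const, probReal_univ, one_smul] at hf
  linarith

theorem nonneg_of_const_mem_kantorovichCone
    (hφ : ∀ (f : C(X, ℝ)) (g : C(Y, ℝ)), (∀ x y, φ (x, y) ≤ f x + g y) →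
      c ≤ ∫ x, f x ∂μ + ∫ y, g y ∂ν)
    {a : ℝ} (ha : ContinuousMap.const (X × Y) a ∈ kantorovichCone μ ν φ c) : 0 ≤ a := by
  obtain ⟨f, g, t, hfg, ht, H⟩ := ha
  rcases ht.eq_or_lt with rfl | ht
  · refine hfg.trans (integral_add_integral_le_of_add_le fun x y => ?_)
    simpa using H (x, y)
  · have hle := hφ (t⁻¹ • (ContinuousMap.const X (a + t * c) - f)) (t⁻¹ • -g) fun x y => by
      have : f x + g y + t * (φ (x, y) - c) ≤ a := H (x, y)
      simp only [ContinuousMap.smul_apply, ContinuousMap.sub_apply, ContinuousMap.neg_apply,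
        ContinuousMap.const_apply, smul_eq_mul, ← mul_add]
      rw [inv_mul_eq_div, le_div_iff₀ ht]
      linarith
    simp only [ContinuousMap.smul_apply, ContinuousMap.sub_apply, ContinuousMap.neg_apply,
      ContinuousMap.const_apply, smul_eq_mul, integral_const_mul, integral_neg, ← mul_add] at hle
    rw [integral_sub (integrable_const _) (integrable_continuousMap f μ), inv_mul_eq_div,
      le_div_iff₀ ht] at hle
    simp only [integral_const, probReal_univ, one_smul] at hle
    linarith

theorem exists_linearMap_nonneg_on_kantorovichCone
    (hφ : ∀ (f : C(X, ℝ)) (g : C(Y, ℝ)), (∀ x y, φ (x, y) ≤ f x + g y) →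
      c ≤ ∫ x, f x ∂μ + ∫ y, g y ∂ν) :
    ∃ L : C(X × Y, ℝ) →ₗ[ℝ] ℝ, L 1 = 1 ∧ ∀ h ∈ kantorovichCone μ ν φ c, 0 ≤ L h := by
  have : Nonempty X := nonempty_of_isProbabilityMeasure μ
  have : Nonempty Y := nonempty_of_isProbabilityMeasure ν
  let Λ : C(X × Y, ℝ) →ₗ.[ℝ] ℝ :=
    LinearPMap.mkSpanSingleton (σ := RingHom.id ℝ) (1 : C(X × Y, ℝ)) (1 : ℝ) one_ne_zero
  have hΛ : ∀ h : Λ.domain, (h : C(X × Y, ℝ)) ∈ kantorovichCone μ ν φ c → 0 ≤ Λ h := by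
    rintro ⟨h, hh⟩ hcone
    obtain ⟨a, rfl⟩ := Submodule.mem_span_singleton.1 hh
    have hconst : a • (1 : C(X × Y, ℝ)) = ContinuousMap.const _ a := by ext; simp
    rw [LinearPMap.mkSpanSingleton'_apply]
    simpa using nonneg_of_const_mem_kantorovichCone hφ (hconst ▸ hcone)
  have hdense : ∀ h, ∃ k : Λ.domain, (k : C(X × Y, ℝ)) + h ∈ kantorovichCone μ ν φ c := fun h =>
    ⟨⟨‖h‖ • 1, Submodule.smul_mem _ _ (Submodule.mem_span_singleton_self _)⟩,
      0, 0, 0, by simp, le_rfl, fun p => by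
        simpa using neg_le_iff_add_nonneg'.1 (h.neg_norm_le_apply p)⟩
  obtain ⟨L, hLΛ, hL⟩ := riesz_extension _ Λ hΛ hdense
  refine ⟨L, ?_, hL⟩
  rw [hLΛ ⟨1, Submodule.mem_span_singleton_self _⟩, LinearPMap.mkSpanSingleton_apply]

variable [T2Space X] [T2Space Y] [SecondCountableTopology X] [SecondCountableTopology Y]

theorem eq_of_forall_integral_continuousMap_le {μ₁ μ₂ : Measure X} [IsFiniteMeasure μ₁]
    [IsFiniteMeasure μ₂] (h : ∀ f : C(X, ℝ), ∫ x, f x ∂μ₁ ≤ ∫ x, f x ∂μ₂) : μ₁ = μ₂ := by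
  refine ext_of_forall_integral_eq_of_IsFiniteMeasure fun f => le_antisymm (h f.toContinuousMap) ?_
  have hneg := h (-f.toContinuousMap)
  simp only [ContinuousMap.neg_apply, integral_neg] at hneg
  exact neg_le_neg_iff.1 hneg

/-- One half of Kantorovich duality: if every pair of potentials dominating `φ` costs at least `c`,
then some coupling gives `φ` at least the value `c`. As `φ` need not be measurable, that value is
expressed through the continuous functions above `φ`. -/
theorem exists_coupling_forall_le_integral
    (hφ : ∀ (f : C(X, ℝ)) (g : C(Y, ℝ)), (∀ x y, φ (x, y) ≤ f x + g y) →
      c ≤ ∫ x, f x ∂μ + ∫ y, g y ∂ν) :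
    ∃ π : Measure (X × Y), π.fst = μ ∧ π.snd = ν ∧
      ∀ h : C(X × Y, ℝ), (∀ p, φ p ≤ h p) → c ≤ ∫ p, h p ∂π := by
  obtain ⟨L, hL1, hL⟩ := exists_linearMap_nonneg_on_kantorovichCone hφ
  obtain ⟨π, _, hπ⟩ := exists_isFiniteMeasure_integral_eq L fun h hh =>
    hL h ⟨0, 0, 0, by simp, le_rfl, fun p => by simpa using hh p⟩
  have le_integral : ∀ (h : C(X × Y, ℝ)) (a : ℝ),
      h - ContinuousMap.const _ a ∈ kantorovichCone μ ν φ c → a ≤ ∫ p, h p ∂π := by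
    intro h a hmem
    have hconst : ContinuousMap.const (X × Y) a = a • 1 := by ext; simp
    have := hL _ hmem
    rw [map_sub, hconst, map_smul, hL1, smul_eq_mul, mul_one, ← hπ] at this
    exact sub_nonneg.1 this
  refine ⟨π, ?_, ?_, fun h hh => le_integral h c
    ⟨0, 0, 1, by simp, zero_le_one, fun p => by simpa using hh p⟩⟩
  · refine (eq_of_forall_integral_continuousMap_le fun f => ?_).symm
    rw [Measure.fst, integral_map measurable_fst.aemeasurable f.continuous.aestronglyMeasurable]
    exact le_integral (f.comp .fst) _ ⟨f - .const _ (∫ x, f x ∂μ), 0, 0,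
      by simp [integral_sub (integrable_continuousMap f μ)], le_rfl, fun p => by simp⟩
  · refine (eq_of_forall_integral_continuousMap_le fun g => ?_).symm
    rw [Measure.snd, integral_map measurable_snd.aemeasurable g.continuous.aestronglyMeasurable]
    exact le_integral (g.comp .snd) _ ⟨0, g - .const _ (∫ y, g y ∂ν), 0,
      by simp [integral_sub (integrable_continuousMap g ν)], le_rfl, fun p => by simp⟩

end Kantorovich

section Strassen

theorem intervalIntegral_measureReal_le_integral {X : Type*} [MeasurableSpace X]
    {μ : Measure X} [IsFiniteMeasure μ] {f : X → ℝ} (hf : Integrable f μ) (hf0 : ∀ x, 0 ≤ f x) :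
    ∫ t in (0 : ℝ)..1, μ.real {x | t ≤ f x} ≤ ∫ x, f x ∂μ := by
  have hmin : Integrable (fun x => min (f x) 1) μ := hf.inf (integrable_const 1)
  calc ∫ t in (0 : ℝ)..1, μ.real {x | t ≤ f x}
      = ∫ t in Ioc (0 : ℝ) 1, μ.real {x | t ≤ min (f x) 1} := by
        rw [intervalIntegral.integral_of_le zero_le_one]
        refine setIntegral_congr_fun measurableSet_Ioc fun t ht => ?_
        simp only [le_min_iff, ht.2, and_true]
    _ = ∫ x, min (f x) 1 ∂μ := (hmin.integral_eq_integral_Ioc_meas_le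
        (.of_forall fun x => le_min (hf0 x) zero_le_one)
        (.of_forall fun x => min_le_right _ _)).symm
    _ ≤ ∫ x, f x ∂μ := integral_mono hmin hf fun x => min_le_left _ _

section Potentials

variable {X Y : Type*} [TopologicalSpace X] [MeasurableSpace X] [MeasurableSpace Y]
  {R : SetRel X Y} {μ : Measure X} {ν : Measure Y} {f : X → ℝ} {g : Y → ℝ}
  [IsProbabilityMeasure μ] [IsProbabilityMeasure ν] [μ.InnerRegularCompactLTTop]

theorem one_sub_hallExcess_le_measureReal_add (hfm : Measurable f)
    (h : ∀ x y, (x, y) ∈ R → 1 ≤ f x + g y) (t : ℝ) :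
    1 - hallExcess R μ ν ≤ μ.real {x | t ≤ f x} + ν.real {y | 1 - t ≤ g y} := by
  have himage : R.image {x | t ≤ f x}ᶜ ⊆ {y | 1 - t ≤ g y} := by
    rintro y ⟨x, hx, hxy⟩
    have hlt : f x < t := not_le.1 hx
    have := h x y hxy
    simp only [mem_ofPred_eq]
    linarith
  have hmeas : MeasurableSet {x | t ≤ f x} := measurableSet_le measurable_const hfm
  have := sub_le_hallExcess_of_image_subset (μ := μ) (ν := ν) hmeas.compl himage
  rw [probReal_compl_eq_one_sub hmeas] at this
  linarith

theorem one_sub_hallExcess_le_integral_add_of_nonneg (hfm : Measurable f) (hf : Integrable f μ)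
    (hg : Integrable g ν) (hf0 : ∀ x, 0 ≤ f x) (hg0 : ∀ y, 0 ≤ g y)
    (h : ∀ x y, (x, y) ∈ R → 1 ≤ f x + g y) :
    1 - hallExcess R μ ν ≤ ∫ x, f x ∂μ + ∫ y, g y ∂ν := by
  have hF : Antitone fun t : ℝ => μ.real {x | t ≤ f x} := fun a b hab =>
    measureReal_mono fun x hx => hab.trans hx
  have hG : Monotone fun t : ℝ => ν.real {y | 1 - t ≤ g y} := fun a b hab =>
    measureReal_mono fun x hx => (sub_le_sub_left hab 1).trans hx
  calc 1 - hallExcess R μ ν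
      = ∫ _ in (0 : ℝ)..1, (1 - hallExcess R μ ν) := by simp
    _ ≤ ∫ t in (0 : ℝ)..1, (μ.real {x | t ≤ f x} + ν.real {y | 1 - t ≤ g y}) :=
        intervalIntegral.integral_mono_on zero_le_one (by simp)
          (hF.intervalIntegrable.add hG.intervalIntegrable)
          fun t _ => one_sub_hallExcess_le_measureReal_add hfm h t
    _ = (∫ t in (0 : ℝ)..1, μ.real {x | t ≤ f x}) + ∫ t in (0 : ℝ)..1, ν.real {y | t ≤ g y} := by
        rw [intervalIntegral.integral_add hF.intervalIntegrable hG.intervalIntegrable,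
          intervalIntegral.integral_comp_sub_left (fun t => ν.real {y | t ≤ g y}), sub_self,
          sub_zero]
    _ ≤ ∫ x, f x ∂μ + ∫ y, g y ∂ν :=
        add_le_add (intervalIntegral_measureReal_le_integral hf hf0)
          (intervalIntegral_measureReal_le_integral hg hg0)

theorem one_sub_hallExcess_le_integral_add (hfm : Measurable f) (hf : Integrable f μ)
    (hg : Integrable g ν) (h0 : ∀ x y, 0 ≤ f x + g y) (h : ∀ x y, (x, y) ∈ R → 1 ≤ f x + g y) :
    1 - hallExcess R μ ν ≤ ∫ x, f x ∂μ + ∫ y, g y ∂ν := by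
  have : Nonempty X := nonempty_of_isProbabilityMeasure μ
  obtain ⟨y₀⟩ : Nonempty Y := nonempty_of_isProbabilityMeasure ν
  set m := ⨅ x, f x
  have hbdd : BddBelow (range f) := ⟨-g y₀, by rintro _ ⟨x, rfl⟩; linarith [h0 x y₀]⟩
  have hm : ∀ y, -g y ≤ m := fun y => le_ciInf fun x => by linarith [h0 x y]
  have := one_sub_hallExcess_le_integral_add_of_nonneg (R := R) (f := fun x => f x - m)
    (g := fun y => g y + m) (hfm.sub_const m) (hf.sub (integrable_const m))
    (hg.add (integrable_const m)) (fun x => sub_nonneg.2 (ciInf_le hbdd x))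
    (fun y => by linarith [hm y]) (fun x y hxy => by linarith [h x y hxy])
  rw [integral_sub hf (integrable_const m), integral_add hg (integrable_const m)] at this
  simp only [integral_const, probReal_univ, one_smul] at this
  linarith

end Potentials

theorem le_measureReal_of_forall_le_integral {X : Type*} [TopologicalSpace X]
    [HasOuterApproxClosed X] [MeasurableSpace X] [OpensMeasurableSpace X] {μ : Measure X}
    [IsFiniteMeasure μ] {F : Set X} (hF : IsClosed F) {c : ℝ}
    (h : ∀ f : C(X, ℝ), (∀ x, F.indicator 1 x ≤ f x) → c ≤ ∫ x, f x ∂μ) : c ≤ μ.real F := by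
  rw [measureReal_def, ← ENNReal.ofReal_le_iff_le_toReal (measure_ne_top μ F)]
  refine ge_of_tendsto' (HasOuterApproxClosed.tendsto_lintegral_apprSeq hF μ) fun k => ?_
  refine ENNReal.ofReal_le_of_le_toReal ?_
  rw [BoundedContinuousFunction.toReal_lintegral_coe_eq_integral]
  refine h ⟨fun x => hF.apprSeq k x, by fun_prop⟩ fun x => ?_
  by_cases hx : x ∈ F
  · simp [hx, HasOuterApproxClosed.apprSeq_apply_eq_one hF k hx]
  · simp [hx]

theorem hallExcess_map_le {X Y X' Y' : Type*} [TopologicalSpace X] [MeasurableSpace X]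
    [MeasurableSpace Y] [TopologicalSpace X'] [MeasurableSpace X'] [T2Space X']
    [OpensMeasurableSpace X'] [MeasurableSpace Y']
    {μ : Measure X} {ν : Measure Y} [IsFiniteMeasure μ] [IsFiniteMeasure ν]
    [μ.InnerRegularCompactLTTop] {R : SetRel X Y} {R' : SetRel X' Y'} {e : X → X'} {e' : Y → Y'}
    (he : Measurable e) (he' : Measurable e') (h : ∀ x y, (x, y) ∈ R → (e x, e' y) ∈ R') :
    hallExcess R' (μ.map e) (ν.map e') ≤ hallExcess R μ ν := by
  refine hallExcess_le fun K hK => ?_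
  have himage : R.image (e ⁻¹' K) ⊆ e' ⁻¹' R'.image K := by
    rintro y ⟨x, hx, hxy⟩
    exact ⟨e x, hx, h x y hxy⟩
  have hμ : (μ.map e).real K = μ.real (e ⁻¹' K) := map_measureReal_apply he hK.measurableSet
  have hν : ν.real (e' ⁻¹' R'.image K) ≤ (ν.map e').real (R'.image K) :=
    ENNReal.toReal_mono (measure_ne_top _ _) (Measure.le_map_apply he'.aemeasurable _)
  linarith [sub_le_hallExcess_of_image_subset (μ := μ) (ν := ν) (he hK.measurableSet) himage]

theorem exists_coupling_map_prodMap_eq {X Y X' Y' : Type*} [MeasurableSpace X] [MeasurableSpace Y]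
    [MeasurableSpace X'] [MeasurableSpace Y']
    {e : X → X'} {e' : Y → Y'} (he : MeasurableEmbedding e) (he' : MeasurableEmbedding e')
    {μ : Measure X} {ν : Measure Y} {π' : Measure (X' × Y')} (hfst : π'.fst = μ.map e)
    (hsnd : π'.snd = ν.map e') :
    ∃ π : Measure (X × Y), π.fst = μ ∧ π.snd = ν ∧ π.map (Prod.map e e') = π' := by
  have hE : MeasurableEmbedding (Prod.map e e') := he.prodMap he'
  have hrange : ∀ᵐ p ∂π', p ∈ range (Prod.map e e') := by
    have h1 : ∀ᵐ x ∂π'.fst, x ∈ range e :=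
      hfst ▸ (ae_map_mem_range e he.measurableSet_range μ)
    have h2 : ∀ᵐ y ∂π'.snd, y ∈ range e' :=
      hsnd ▸ (ae_map_mem_range e' he'.measurableSet_range ν)
    filter_upwards [ae_of_ae_map measurable_fst.aemeasurable h1,
      ae_of_ae_map measurable_snd.aemeasurable h2] with p hp hp'
    rw [range_prodMap]
    exact ⟨hp, hp'⟩
  have hmap : (π'.comap (Prod.map e e')).map (Prod.map e e') = π' := by
    rw [hE.map_comap, Measure.restrict_eq_self_of_ae_mem hrange]
  refine ⟨π'.comap (Prod.map e e'), ?_, ?_, hmap⟩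
  · refine he.map_injective ?_
    rw [← hfst]
    nth_rw 2 [← hmap]
    rw [Measure.fst, Measure.fst, Measure.map_map he.measurable measurable_fst,
      Measure.map_map measurable_fst hE.measurable]
    rfl
  · refine he'.map_injective ?_
    rw [← hsnd]
    nth_rw 2 [← hmap]
    rw [Measure.snd, Measure.snd, Measure.map_map he'.measurable measurable_snd,
      Measure.map_map measurable_snd hE.measurable]
    rfl

variable {X Y : Type*} [TopologicalSpace X] [TopologicalSpace Y]
  [MeasurableSpace X] [MeasurableSpace Y] [BorelSpace X] [BorelSpace Y]

theorem exists_coupling_compl_le_hallExcess_of_compactSpace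
    [CompactSpace X] [CompactSpace Y] [T2Space X] [T2Space Y] [SecondCountableTopology X]
    [SecondCountableTopology Y] (μ : Measure X) (ν : Measure Y) [IsProbabilityMeasure μ]
    [IsProbabilityMeasure ν] {R : SetRel X Y} (hR : IsClosed R) :
    ∃ π : Measure (X × Y), π.fst = μ ∧ π.snd = ν ∧ π.real Rᶜ ≤ hallExcess R μ ν := by
  obtain ⟨π, rfl, rfl, hπ⟩ := exists_coupling_forall_le_integral (μ := μ) (ν := ν)
    (φ := R.indicator 1) (c := 1 - hallExcess R μ ν) fun f g hfg =>
      one_sub_hallExcess_le_integral_add f.continuous.measurable (integrable_continuousMap f μ)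
        (integrable_continuousMap g ν)
        (fun x y => (indicator_nonneg (fun _ _ => zero_le_one) _).trans (hfg x y))
        fun x y hxy => by simpa [indicator_of_mem hxy] using hfg x y
  have : IsProbabilityMeasure π := ⟨by rw [← Measure.fst_univ, measure_univ]⟩
  refine ⟨π, rfl, rfl, ?_⟩
  rw [probReal_compl_eq_one_sub hR.measurableSet]
  linarith [le_measureReal_of_forall_le_integral hR hπ]

variable [PolishSpace X] [PolishSpace Y]

/-- **Strassen's theorem**, reduced to compact spaces by embedding into Hilbert cubes. -/
theorem exists_coupling_compl_le_hallExcess (μ : Measure X) (ν : Measure Y)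
    [IsProbabilityMeasure μ] [IsProbabilityMeasure ν] {R : SetRel X Y} (hR : IsClosed R) :
    ∃ π : Measure (X × Y), π.fst = μ ∧ π.snd = ν ∧ π.real Rᶜ ≤ hallExcess R μ ν := by
  let := TopologicalSpace.upgradeIsCompletelyMetrizable X
  let := TopologicalSpace.upgradeIsCompletelyMetrizable Y
  obtain ⟨e, he⟩ := Metric.PiNatEmbed.exists_embedding_to_hilbert_cube (X := X)
  obtain ⟨e', he'⟩ := Metric.PiNatEmbed.exists_embedding_to_hilbert_cube (X := Y)
  have hem := he.continuous.measurableEmbedding he.injective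
  have hem' := he'.continuous.measurableEmbedding he'.injective
  set E := Prod.map e e'
  have := Measure.isProbabilityMeasure_map (μ := μ) hem.measurable.aemeasurable
  have := Measure.isProbabilityMeasure_map (μ := ν) hem'.measurable.aemeasurable
  obtain ⟨π', hfst, hsnd, hπ'⟩ := exists_coupling_compl_le_hallExcess_of_compactSpace
    (μ.map e) (ν.map e') (R := closure (E '' R)) isClosed_closure
  obtain ⟨π, rfl, rfl, rfl⟩ := exists_coupling_map_prodMap_eq hem hem' hfst hsnd
  have hpre : E ⁻¹' closure (E '' R) = R := by
    rw [← (he.prodMap he').isInducing.closure_eq_preimage_closure_image, hR.closure_eq]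
  refine ⟨π, rfl, rfl, ?_⟩
  calc π.real Rᶜ = (π.map E).real (closure (E '' R))ᶜ := by
        rw [map_measureReal_apply (hem.prodMap hem').measurable
          isClosed_closure.measurableSet.compl, preimage_compl, hpre]
    _ ≤ _ := hπ'
    _ ≤ hallExcess R π.fst π.snd := hallExcess_map_le hem.measurable hem'.measurable fun x y h =>
        subset_closure ⟨(x, y), h, rfl⟩

theorem iInf_coupling_measureReal_compl_eq_hallExcess (μ ν : Measure X)
    [IsProbabilityMeasure μ] [IsProbabilityMeasure ν] {R : SetRel X X} (hR : IsClosed R) :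
    ⨅ π : {π : Measure (X × X) // IsCoupling π μ ν}, π.1.real Rᶜ = hallExcess R μ ν := by
  obtain ⟨π₀, hfst, hsnd, hπ₀⟩ := exists_coupling_compl_le_hallExcess μ ν hR
  have : Nonempty {π : Measure (X × X) // IsCoupling π μ ν} := ⟨π₀, hfst, hsnd⟩
  refine le_antisymm (ciInf_le_of_le ⟨0, ?_⟩ ⟨π₀, hfst, hsnd⟩ hπ₀) (le_ciInf ?_)
  · rintro _ ⟨π, rfl⟩
    exact measureReal_nonneg
  · rintro ⟨π, hfst, hsnd⟩
    have : IsFiniteMeasure π :=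
      ⟨by rw [← Measure.fst_univ, Measure.fst, hfst]; exact measure_lt_top μ univ⟩
    exact hfst ▸ hsnd ▸ hallExcess_fst_snd_le

end Strassen

section Geometry

variable {X : Type*} {d : X → X → ℝ}

theorem IsMetric.self_eq_zero (hd : IsMetric d) (x : X) : d x x = 0 :=
  (hd.eq_zero_iff x x).2 rfl

theorem IsMetric.nonneg (hd : IsMetric d) (x y : X) : 0 ≤ d x y := by
  have := hd.triangle x y x
  rw [hd.self_eq_zero, hd.symm y x] at this
  linarith

theorem HasApproxMidpoints.exists_dist_lt_pow (hm : HasApproxMidpoints d) (hd : IsMetric d)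
    {x y : X} {r : ℝ} (h : d x y < r) (k : ℕ) :
    ∃ p, d x p ≤ (1 - (1 / 2) ^ k) * r ∧ d p y < (1 / 2) ^ k * r := by
  induction k with
  | zero => exact ⟨x, by simp [hd.self_eq_zero], by simpa using h⟩
  | succ k ih =>
    obtain ⟨p, hxp, hpy⟩ := ih
    obtain ⟨q, hpq, hqy⟩ := hm p y ((1 / 2) ^ (k + 1) * r) (by rw [pow_succ]; linarith)
    refine ⟨q, (hd.triangle x p q).trans ?_, hqy⟩
    rw [pow_succ] at hpq ⊢
    linarith

/-- The midpoint is moved slightly towards `x`, which makes the first inequality strict. -/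
theorem HasApproxMidpoints.exists_dist_lt_of_le_two_mul (hm : HasApproxMidpoints d)
    (hd : IsMetric d) {x y : X} {ε z : ℝ} (hε : 0 < ε) (hxy : d x y ≤ 2 * ε) (hz : ε < z) :
    ∃ m, d x m < ε ∧ d m y < z := by
  obtain ⟨k, hk⟩ := exists_pow_lt_of_lt_one (div_pos (sub_pos.2 hz) (mul_pos three_pos hε))
    one_half_lt_one
  set q : ℝ := (1 / 2) ^ k
  have hq0 : 0 < q := by positivity
  have hq1 : q ≤ 1 := pow_le_one₀ (by norm_num) (by norm_num)
  have hqz : q * (3 * ε) < z - ε := (lt_div_iff₀ (by positivity)).1 hk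
  obtain ⟨m, hxm, hmy⟩ := hm x y (ε * (1 + q)) (by nlinarith [mul_pos hε hq0])
  obtain ⟨p, hxp, hpm⟩ := hm.exists_dist_lt_pow hd hxm k
  refine ⟨p, hxp.trans_lt ?_, (hd.triangle p m y).trans_lt ?_⟩
  · calc (1 - q) * (ε * (1 + q)) = ε - ε * q ^ 2 := by ring
      _ < ε := sub_lt_self _ (by positivity)
  · calc d p m + d m y < q * (ε * (1 + q)) + ε * (1 + q) := add_lt_add hpm hmy
      _ = ε + q * (ε * (2 + q)) := by ring
      _ ≤ ε + q * (3 * ε) := by gcongr ε + q * ?_; nlinarith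
      _ < z := by linarith

variable {B K : Set X} {x : X} {r ε : ℝ}

theorem mem_offset_of_mem (hx : x ∈ B) : x ∈ offset d B r ↔ ∀ y ∉ B, -r ≤ d x y := by
  simp only [offset, signedDistTo, hx, if_true, distToSet, mem_ofPred_eq, EReal.neg_le,
    le_iInf_iff, mem_compl_iff, ← EReal.coe_neg, EReal.coe_le_coe_iff]

theorem mem_offset_of_notMem (hx : x ∉ B) :
    x ∈ offset d B r ↔ ∀ s > r, ∃ y ∈ B, d x y < s := by
  simp only [offset, signedDistTo, hx, if_false, distToSet, mem_ofPred_eq]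
  constructor
  · intro h s hs
    simpa only [iInf_lt_iff, EReal.coe_lt_coe_iff, exists_prop] using
      h.trans_lt (EReal.coe_lt_coe_iff.2 hs)
  · refine fun h => EReal.le_of_forall_lt_iff_le.1 fun s hs => ?_
    obtain ⟨y, hy, hlt⟩ := h s (EReal.coe_lt_coe_iff.1 hs)
    exact (iInf₂_le y hy).trans (EReal.coe_le_coe_iff.2 hlt.le)

theorem measurableSet_offset [TopologicalSpace X] [MeasurableSpace X] [OpensMeasurableSpace X]
    (hc : Continuous fun p : X × X => d p.1 p.2) (hB : MeasurableSet B) (r : ℝ) :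
    MeasurableSet (offset d B r) := by
  classical
  have hdist : ∀ A : Set X, Measurable fun x => distToSet d x A := fun A =>
    (upperSemicontinuous_biInf fun y _ => (continuous_coe_real_ereal.comp
      (hc.comp (Continuous.prodMk_left y))).upperSemicontinuous).measurable
  exact (Measurable.ite hB (hdist Bᶜ).neg (hdist B)) measurableSet_Iic

/-- The relation of being at `d`-distance at most `r`. Its image of a set is the closed
`r`-neighbourhood of that set when the set is compact. -/
def closeRel (d : X → X → ℝ) (r : ℝ) : SetRel X X := {p | d p.1 p.2 ≤ r}

theorem closeRel_inv (hd : IsMetric d) (r : ℝ) : (closeRel d r).inv = closeRel d r := by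
  ext ⟨x, y⟩
  exact (hd.symm y x ▸ Iff.rfl : d y x ≤ r ↔ d x y ≤ r)

theorem isClosed_closeRel [TopologicalSpace X] (hc : Continuous fun p : X × X => d p.1 p.2)
    (r : ℝ) : IsClosed (closeRel d r) :=
  isClosed_le hc continuous_const

theorem image_closeRel_offset_neg_subset (hd : IsMetric d) (hm : HasApproxMidpoints d)
    (hε : 0 ≤ ε) : (closeRel d (2 * ε)).image (offset d B (-ε)) ⊆ offset d B ε := by
  rintro y ⟨x, hx, hxy : d x y ≤ 2 * ε⟩
  rcases hε.eq_or_lt with rfl | hε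
  · obtain rfl := (hd.eq_zero_iff x y).1 (le_antisymm (by simpa using hxy) (hd.nonneg x y))
    simpa using hx
  have hxB : x ∈ B := by
    by_contra hxB
    obtain ⟨z, -, hz⟩ := (mem_offset_of_notMem hxB).1 hx 0 (by linarith)
    exact hz.not_ge (hd.nonneg x z)
  rw [mem_offset_of_mem hxB, neg_neg] at hx
  by_cases hyB : y ∈ B
  · exact (mem_offset_of_mem hyB).2 fun z _ => by linarith [hd.nonneg y z]
  · refine (mem_offset_of_notMem hyB).2 fun s hs => ?_
    obtain ⟨m, hxm, hmy⟩ := hm.exists_dist_lt_of_le_two_mul hd hε hxy hs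
    refine ⟨m, ?_, hd.symm y m ▸ hmy⟩
    by_contra hmB
    exact (hx m hmB).not_gt hxm

theorem subset_offset_neg_image_closeRel (hd : IsMetric d) (hε : 0 ≤ ε) :
    K ⊆ offset d ((closeRel d ε).image K) (-ε) := fun x hx => by
  have hself : x ∈ (closeRel d ε).image K := ⟨x, hx, (hd.self_eq_zero x).trans_le hε⟩
  refine (mem_offset_of_mem hself).2 fun y hy => ?_
  rw [neg_neg]
  exact le_of_not_ge fun hxy => hy ⟨x, hx, hxy⟩

theorem mem_image_closeRel_of_forall_exists_lt [TopologicalSpace X]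
    (hc : Continuous fun p : X × X => d p.1 p.2) (hK : IsCompact K)
    (h : ∀ s > r, ∃ k ∈ K, d k x < s) : x ∈ (closeRel d r).image K := by
  obtain ⟨k₀, hk₀, -⟩ := h (r + 1) (lt_add_one r)
  obtain ⟨k, hk, hmin⟩ := hK.exists_isMinOn ⟨k₀, hk₀⟩
    (hc.comp (Continuous.prodMk_left x)).continuousOn
  have hle : d k x ≤ r := le_of_forall_gt fun s hs => by
    obtain ⟨k', hk', hlt⟩ := h s hs
    exact (hmin hk').trans_lt hlt
  exact ⟨k, hk, hle⟩

theorem offset_image_closeRel_subset [TopologicalSpace X] (hd : IsMetric d)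
    (hc : Continuous fun p : X × X => d p.1 p.2) (hε : 0 ≤ ε) (hK : IsCompact K) :
    offset d ((closeRel d ε).image K) ε ⊆ (closeRel d (2 * ε)).image K := by
  intro x hx
  by_cases hxK : x ∈ (closeRel d ε).image K
  · obtain ⟨k, hk, hkx : d k x ≤ ε⟩ := hxK
    exact ⟨k, hk, hkx.trans (by linarith)⟩
  · refine mem_image_closeRel_of_forall_exists_lt hc hK fun s hs => ?_
    obtain ⟨y, ⟨k, hk, hky : d k y ≤ ε⟩, hxy⟩ :=
      (mem_offset_of_notMem hxK).1 hx (s - ε) (by linarith)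
    rw [hd.symm] at hxy
    exact ⟨k, hk, by linarith [hd.triangle k y x]⟩

variable [TopologicalSpace X] [MeasurableSpace X] [OpensMeasurableSpace X]
  {μ ν : Measure X} [IsFiniteMeasure μ] [IsFiniteMeasure ν] [μ.InnerRegularCompactLTTop]

theorem offset_sub_offset_le_hallExcess (hd : IsMetric d)
    (hc : Continuous fun p : X × X => d p.1 p.2) (hm : HasApproxMidpoints d) (hε : 0 ≤ ε)
    (hB : MeasurableSet B) :
    μ.real (offset d B (-ε)) - ν.real (offset d B ε) ≤ hallExcess (closeRel d (2 * ε)) μ ν :=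
  sub_le_hallExcess_of_image_subset (measurableSet_offset hc hB _)
    (image_closeRel_offset_neg_subset hd hm hε)

theorem iSup_offset_sub_offset_eq_hallExcess [T2Space X] (hd : IsMetric d)
    (hc : Continuous fun p : X × X => d p.1 p.2) (hm : HasApproxMidpoints d) (hε : 0 ≤ ε) :
    ⨆ B : {B : Set X // MeasurableSet B}, (μ.real (offset d B (-ε)) - ν.real (offset d B ε)) =
      hallExcess (closeRel d (2 * ε)) μ ν := by
  have : Nonempty {B : Set X // MeasurableSet B} := ⟨∅, .empty⟩
  refine le_antisymm (ciSup_le fun B => offset_sub_offset_le_hallExcess hd hc hm hε B.2)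
    (hallExcess_le fun K hK => ?_)
  have hB : MeasurableSet ((closeRel d ε).image K) :=
    ((isClosed_closeRel hc ε).relImage_of_isCompact hK).measurableSet
  calc μ.real K - ν.real ((closeRel d (2 * ε)).image K)
      ≤ μ.real (offset d ((closeRel d ε).image K) (-ε)) -
          ν.real (offset d ((closeRel d ε).image K) ε) :=
        sub_le_sub (measureReal_mono (subset_offset_neg_image_closeRel hd hε))
          (measureReal_mono (offset_image_closeRel_subset hd hc hε hK))
    _ ≤ _ := le_ciSup (f := fun B : {B : Set X // MeasurableSet B} =>
          μ.real (offset d B (-ε)) - ν.real (offset d B ε)) ⟨_, by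
            rintro _ ⟨B, rfl⟩
            exact offset_sub_offset_le_hallExcess hd hc hm hε B.2⟩ ⟨_, hB⟩

end Geometry

section Labels

/-- The restriction of `μ` to the points labelled `i`, viewed as a measure on the base space. -/
noncomputable def labelSlice {X ι : Type*} [MeasurableSpace X] [MeasurableSpace ι]
    (μ : Measure (X × ι)) (i : ι) : Measure X :=
  μ.comap fun x => (x, i)

/-- Being related by `R` in the first coordinate and equal in the second one. -/
def labelRel {X Y : Type*} (R : SetRel X Y) (ι : Type*) : SetRel (X × ι) (Y × ι) :=
  {p | (p.1.1, p.2.1) ∈ R ∧ p.1.2 = p.2.2}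

variable {X Y ι : Type*} {R : SetRel X Y}

theorem preimage_image_labelRel (K : Set (X × ι)) (i : ι) :
    (fun y => (y, i)) ⁻¹' (labelRel R ι).image K = R.image ((fun x => (x, i)) ⁻¹' K) := by
  ext y
  constructor
  · rintro ⟨⟨x, j⟩, hx, hxy, hij⟩
    obtain rfl : j = i := hij
    exact ⟨x, hx, hxy⟩
  · rintro ⟨x, hx, hxy⟩
    exact ⟨(x, i), hx, hxy, rfl⟩

theorem isClosed_labelRel [TopologicalSpace X] [TopologicalSpace Y] [TopologicalSpace ι]
    [T2Space ι] (hR : IsClosed R) : IsClosed (labelRel R ι) :=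
  (hR.preimage (by fun_prop : Continuous fun p : (X × ι) × Y × ι => (p.1.1, p.2.1))).inter
    (isClosed_eq (by fun_prop) (by fun_prop))

theorem isCompact_preimage_prodMk_right [TopologicalSpace X] [TopologicalSpace ι] [T1Space ι]
    {K : Set (X × ι)} (hK : IsCompact K) (i : ι) : IsCompact ((fun x => (x, i)) ⁻¹' K) := by
  refine (isEmbedding_prodMkLeft i).isInducing.isCompact_preimage ?_ hK
  rw [← image_univ, ← prod_singleton]
  exact isClosed_univ.prod isClosed_singleton

variable [MeasurableSpace X] [MeasurableSpace Y] [MeasurableSpace ι] [MeasurableSingletonClass ι]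
  {μ : Measure (X × ι)} {ν : Measure (Y × ι)}

instance [IsFiniteMeasure μ] (i : ι) : IsFiniteMeasure (labelSlice μ i) := by
  unfold labelSlice
  infer_instance

theorem labelSlice_real (i : ι) (E : Set X) : (labelSlice μ i).real E = μ.real (E ×ˢ {i}) := by
  rw [measureReal_def, measureReal_def, labelSlice,
    (measurableEmbedding_prod_mk_right i).comap_apply, prod_singleton]

theorem labelSlice_map_prodMap_id {e : Equiv.Perm ι} (he : Measurable e) (i : ι) :
    labelSlice (μ.map (Prod.map id e)) i = labelSlice μ (e.symm i) := by
  ext E hE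
  have hpre : Prod.map id e ⁻¹' (E ×ˢ {i}) = E ×ˢ {e.symm i} := by
    ext ⟨x, j⟩
    simp [Equiv.eq_symm_apply]
  rw [labelSlice, labelSlice, (measurableEmbedding_prod_mk_right i).comap_apply,
    (measurableEmbedding_prod_mk_right (e.symm i)).comap_apply, ← prod_singleton, ← prod_singleton,
    Measure.map_apply (measurable_id.prodMap he) (hE.prod (measurableSet_singleton i)), hpre]

theorem measureReal_eq_sum_labelSlice [Fintype ι] [IsFiniteMeasure μ] {S : Set (X × ι)}
    (hS : MeasurableSet S) :
    μ.real S = ∑ i, (labelSlice μ i).real ((fun x => (x, i)) ⁻¹' S) := by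
  have hunion : S = ⋃ i, ((fun x => (x, i)) ⁻¹' S) ×ˢ {i} := by
    ext ⟨x, i⟩
    simp
  conv_lhs => rw [hunion]
  simp only [labelSlice_real]
  refine measureReal_iUnion_fintype (fun i j hij => ?_) fun i =>
    (measurable_prodMk_right hS).prod (measurableSet_singleton i)
  exact disjoint_left.2 fun z hi hj => hij (hi.2.symm.trans hj.2)

variable [TopologicalSpace X] [TopologicalSpace Y] [TopologicalSpace ι] [DiscreteTopology ι]
  [Fintype ι] [T2Space X] [BorelSpace X] [BorelSpace Y] [BorelSpace ι]
  [IsFiniteMeasure μ] [IsFiniteMeasure ν]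

theorem sub_image_labelRel_eq_sum (hR : IsClosed R) {K : Set (X × ι)} (hK : IsCompact K) :
    μ.real K - ν.real ((labelRel R ι).image K) =
      ∑ i, ((labelSlice μ i).real ((fun x => (x, i)) ⁻¹' K) -
        (labelSlice ν i).real (R.image ((fun x => (x, i)) ⁻¹' K))) := by
  have hN := ((isClosed_labelRel (ι := ι) hR).relImage_of_isCompact hK).measurableSet
  simp only [measureReal_eq_sum_labelSlice hK.measurableSet, measureReal_eq_sum_labelSlice hN,
    preimage_image_labelRel, Finset.sum_sub_distrib]

theorem hallExcess_labelRel (hR : IsClosed R) :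
    hallExcess (labelRel R ι) μ ν = ∑ i, hallExcess R (labelSlice μ i) (labelSlice ν i) := by
  refine le_antisymm (hallExcess_le fun K hK => ?_) (le_of_forall_pos_le_add fun δ hδ => ?_)
  · rw [sub_image_labelRel_eq_sum hR hK]
    exact Finset.sum_le_sum fun i _ => sub_le_hallExcess
      (isCompact_preimage_prodMk_right hK i)
  have hex : ∀ i, ∃ K : TopologicalSpace.Compacts X,
      hallExcess R (labelSlice μ i) (labelSlice ν i) - δ / (Fintype.card ι + 1) <
        (labelSlice μ i).real K - (labelSlice ν i).real (R.image K) := fun i =>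
    exists_lt_of_lt_ciSup (sub_lt_self _ (by positivity))
  choose K hlt using hex
  have hK : IsCompact (⋃ i, (K i : Set X) ×ˢ {i}) :=
    isCompact_iUnion fun i => (K i).isCompact.prod isCompact_singleton
  have hslice : ∀ i, (fun x => (x, i)) ⁻¹' (⋃ j, (K j : Set X) ×ˢ {j}) = K i := fun i => by
    ext x
    simp
  have hdefect := sub_le_hallExcess (R := labelRel R ι) (μ := μ) (ν := ν) hK
  rw [sub_image_labelRel_eq_sum hR hK] at hdefect
  simp only [hslice] at hdefect
  calc ∑ i, hallExcess R (labelSlice μ i) (labelSlice ν i)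
      ≤ ∑ i, ((labelSlice μ i).real (K i) - (labelSlice ν i).real (R.image (K i)) +
          δ / (Fintype.card ι + 1)) :=
        Finset.sum_le_sum fun i _ => (sub_lt_iff_lt_add.1 (hlt i)).le
    _ = ∑ i, ((labelSlice μ i).real (K i) - (labelSlice ν i).real (R.image (K i))) +
          Fintype.card ι * (δ / (Fintype.card ι + 1)) := by
        rw [Finset.sum_add_distrib, Finset.sum_const, Finset.card_univ, nsmul_eq_mul]
    _ ≤ hallExcess (labelRel R ι) μ ν + δ := by
        gcongr
        rw [mul_div_left_comm]
        exact mul_le_of_le_one_right hδ.le (div_le_one_of_le₀ (by linarith) (by positivity))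

end Labels

section AdversarialCost

variable {X : Type*} [TopologicalSpace X] [MeasurableSpace X] [BorelSpace X]
  {d : X → X → ℝ} {ε : ℝ}

theorem integral_advCost [SecondCountableTopology X]
    (hc : Continuous fun p : X × X => d p.1 p.2) (π : Measure ((X × Fin 2) × (X × Fin 2))) :
    ∫ z, advCost d ε z.1 z.2 ∂π = π.real (labelRel (closeRel d (2 * ε)) (Fin 2))ᶜ := by
  have hR : IsClosed (labelRel (closeRel d (2 * ε)) (Fin 2)) :=
    isClosed_labelRel (isClosed_closeRel hc _)
  rw [← integral_indicator_one hR.measurableSet.compl]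
  congr with z
  simp [advCost, indicator, labelRel, closeRel, imp_iff_not_or]

variable [PolishSpace X] (ν : Measure (X × Fin 2)) [IsProbabilityMeasure ν]

theorem iInf_integral_advCost_eq_hallExcess_add (hc : Continuous fun p : X × X => d p.1 p.2) :
    ⨅ π : {π : Measure ((X × Fin 2) × (X × Fin 2)) //
        IsCoupling π ν (ν.map (Prod.map id (Equiv.swap 0 1)))}, ∫ z, advCost d ε z.1 z.2 ∂π.1 =
      hallExcess (closeRel d (2 * ε)) (labelSlice ν 0) (labelSlice ν 1) +
        hallExcess (closeRel d (2 * ε)) (labelSlice ν 1) (labelSlice ν 0) := by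
  have hswap : Measurable (Equiv.swap (0 : Fin 2) 1) := measurable_of_finite _
  have : IsProbabilityMeasure (ν.map (Prod.map id (Equiv.swap 0 1))) :=
    Measure.isProbabilityMeasure_map (measurable_id.prodMap hswap).aemeasurable
  have hR := isClosed_closeRel hc (2 * ε)
  simp only [integral_advCost hc]
  rw [iInf_coupling_measureReal_compl_eq_hallExcess _ _ (isClosed_labelRel hR),
    hallExcess_labelRel hR, Fin.sum_univ_two, labelSlice_map_prodMap_id hswap,
    labelSlice_map_prodMap_id hswap, Equiv.symm_swap, Equiv.swap_apply_left,
    Equiv.swap_apply_right]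

theorem mainTheorem2_general (hd : IsMetric d) (hc : Continuous fun p : X × X => d p.1 p.2)
    (hm : HasApproxMidpoints d) (hε : 0 ≤ ε) {i j : Fin 2} (hij : i ≠ j) :
    BddAbove (range fun B : {B : Set X // MeasurableSet B} =>
      ν.real (offset d B (-ε) ×ˢ {i}) - ν.real (offset d B ε ×ˢ {j})) ∧
    2 * (⨆ B : {B : Set X // MeasurableSet B},
          (ν.real (offset d B (-ε) ×ˢ {i}) - ν.real (offset d B ε ×ˢ {j}))) -
        ν.real (univ ×ˢ {i}) + ν.real (univ ×ˢ {j}) =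
      ⨅ π : {π : Measure ((X × Fin 2) × (X × Fin 2)) //
          IsCoupling π ν (ν.map (Prod.map id (Equiv.swap 0 1)))},
        ∫ z, advCost d ε z.1 z.2 ∂π.1 := by
  have hinv (i j : Fin 2) :=
    hallExcess_le_hallExcess_inv_add (μ := labelSlice ν i) (ν := labelSlice ν j)
      (isClosed_closeRel hc (2 * ε))
  simp only [closeRel_inv hd] at hinv
  simp only [← labelSlice_real, iSup_offset_sub_offset_eq_hallExcess hd hc hm hε,
    iInf_integral_advCost_eq_hallExcess_add ν hc]
  refine ⟨⟨_, forall_mem_range.2 fun B => offset_sub_offset_le_hallExcess hd hc hm hε B.2⟩, ?_⟩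
  have hsum : hallExcess (closeRel d (2 * ε)) (labelSlice ν 0) (labelSlice ν 1) +
        hallExcess (closeRel d (2 * ε)) (labelSlice ν 1) (labelSlice ν 0) =
      hallExcess (closeRel d (2 * ε)) (labelSlice ν i) (labelSlice ν j) +
        hallExcess (closeRel d (2 * ε)) (labelSlice ν j) (labelSlice ν i) := by
    fin_cases i <;> fin_cases j <;> simp_all [add_comm]
  linarith [hinv i j, hinv j i]

end AdversarialCost

section Densities

variable {n : ℕ} {ν : Measure (Labelled n)}

theorem setIntegral_classWeight_mul {ρ : RSpace n → ℝ} (hρ : IsProbDensity ρ) {i : Fin 2}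
    (hν : HasConditionalDensity ν i ρ) {E : Set (RSpace n)} (hE : MeasurableSet E) :
    ∫ x in E, classWeight ν i * ρ x = ν.real (E ×ˢ {i}) := by
  rw [integral_const_mul, classWeight, measureReal_def, measureReal_def, hν E hE,
    ENNReal.toReal_mul, integral_eq_lintegral_of_nonneg_ae (.of_forall hρ.nonneg)
      hρ.measurable.aestronglyMeasurable]

theorem robustGain_classWeight_mul {d : RSpace n → RSpace n → ℝ} {ε : ℝ}
    (hc : Continuous fun p : RSpace n × RSpace n => d p.1 p.2) {ρ ρ' : RSpace n → ℝ}
    (hρ : IsProbDensity ρ) (hρ' : IsProbDensity ρ') {i j : Fin 2}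
    (hi : HasConditionalDensity ν i ρ) (hj : HasConditionalDensity ν j ρ')
    (B : {B : Set (RSpace n) // MeasurableSet B}) :
    robustGain d ε (fun x => classWeight ν i * ρ x) (fun x => classWeight ν j * ρ' x) B =
      ν.real (offset d B (-ε) ×ˢ {i}) - ν.real (offset d B ε ×ˢ {j}) := by
  rw [robustGain, setIntegral_classWeight_mul hρ hi (measurableSet_offset hc B.2 _),
    setIntegral_classWeight_mul hρ' hj (measurableSet_offset hc B.2 _)]

end Densities

theorem mainTheorem2 (n : ℕ) (d : RSpace n → RSpace n → ℝ) (hd : IsMetric d)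
    (hd_cont : Continuous fun p : RSpace n × RSpace n => d p.1 p.2)
    (hd_mid : HasApproxMidpoints d)
    (ε : ℝ) (hε : 0 ≤ ε)
    (ν : Measure (Labelled n)) (hν : IsProbabilityMeasure ν)
    (ρ₀ ρ₁ : RSpace n → ℝ) (hρ₀ : IsProbDensity ρ₀) (hρ₁ : IsProbDensity ρ₁)
    (hν₀ : HasConditionalDensity ν 0 ρ₀) (hν₁ : HasConditionalDensity ν 1 ρ₁)
    (w₀ w₁ : ℝ) (hw₀ : w₀ = classWeight ν 0) (hw₁ : w₁ = classWeight ν 1) :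
    BddAbove (Set.range fun B : {B : Set (RSpace n) // MeasurableSet B} =>
      robustGain d ε (fun x => w₁ * ρ₁ x) (fun x => w₀ * ρ₀ x) B) ∧
    BddAbove (Set.range fun A : {A : Set (RSpace n) // MeasurableSet A} =>
      robustGain d ε (fun x => w₀ * ρ₀ x) (fun x => w₁ * ρ₁ x) A) ∧
    2 * (⨆ B : {B : Set (RSpace n) // MeasurableSet B},
          robustGain d ε (fun x => w₁ * ρ₁ x) (fun x => w₀ * ρ₀ x) B) - w₁ + w₀ =
      (⨅ π : {π : Measure (Labelled n × Labelled n) // IsCoupling π ν (labelSwap ν)},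
          ∫ z, advCost d ε z.1 z.2 ∂π.1) ∧
    2 * (⨆ A : {A : Set (RSpace n) // MeasurableSet A},
          robustGain d ε (fun x => w₀ * ρ₀ x) (fun x => w₁ * ρ₁ x) A) - w₀ + w₁ =
      (⨅ π : {π : Measure (Labelled n × Labelled n) // IsCoupling π ν (labelSwap ν)},
          ∫ z, advCost d ε z.1 z.2 ∂π.1) := by
  subst hw₀ hw₁
  simp only [robustGain_classWeight_mul hd_cont hρ₁ hρ₀ hν₁ hν₀,
    robustGain_classWeight_mul hd_cont hρ₀ hρ₁ hν₀ hν₁]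
  obtain ⟨hbdd₁, heq₁⟩ := mainTheorem2_general ν hd hd_cont hd_mid hε one_ne_zero
  obtain ⟨hbdd₀, heq₀⟩ := mainTheorem2_general ν hd hd_cont hd_mid hε zero_ne_one
  exact ⟨hbdd₁, hbdd₀, heq₁, heq₀⟩
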